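/- Let $\mathbb F_q$ be a finite field with $q$ elements, let $V$ be a vector space of finite dimension $d$ over $\mathbb F_q$, and let $G$ be a subgroup of $GL(V)$. Let $R=\mathbb F_q[V]=\operatorname{Sym}_{\mathbb F_q}(V^*)$ with its standard grading and the natural action of $GL(V)$ (on linear forms, $(\sigma\varphi)(v)=\varphi(\sigma^{-1}v)$), and let $S=R^G$. For $0\le j\le d-1$ let $\mathbf d_{d,j}\in R^{GL(V)}\subseteq S$ be the Dickson invariant of degree $q^d-q^j$, defined by $$\prod_{\varphi\in V^*}(X+\varphi)=X^{q^d}+\sum_{j=0}^{d-1}(-1)^{d-j}\,\mathbf d_{d,j}\,X^{q^j}\quad\text{in } R[X].$$ Let $I$ be a homogeneous ideal of $S$, let $i\ge 0$, let $H^i_I(S)$ be the $i$-th local cohomology module of $S$ with respect to $I$, and put $J_i=\sqrt{\operatorname{ann}_S H^i_I(S)}$. Assume that $J_i\neq 0$ and that the Krull dimension of $S/J_i$ equals $d-g$ for some integer $g\ge 0$. Then $\mathbf d_{d,0},\dots,\mathbf d_{d,g-1}\in J_i$. -/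

import Mathlib

noncomputable section

namespace ModularInvariants

open Polynomial

variable (F : Type*) [Field F] (V : Type*) [AddCommGroup V] [Module F V]

/-- `F[V] = Sym_F(V^*)`. -/
abbrev PolyFun : Type _ := SymmetricAlgebra F (Module.Dual F V)

variable {F V}

/-- The natural action of `GL(V)` on `F[V]`: the algebra endomorphism which on linear forms is
`φ ↦ φ ∘ g⁻¹`. -/
def act (g : LinearMap.GeneralLinearGroup F V) : PolyFun F V →ₐ[F] PolyFun F V :=
  SymmetricAlgebra.lift
    (SymmetricAlgebra.ι F (Module.Dual F V) ∘ₗ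
      LinearMap.dualMap ((g⁻¹ : LinearMap.GeneralLinearGroup F V) : V →ₗ[F] V))

/-- The ring of invariants `F[V]^G`. -/
def invariantRing (G : Subgroup (LinearMap.GeneralLinearGroup F V)) :
    Subalgebra F (PolyFun F V) where
  carrier := {f | ∀ g ∈ G, act g f = f}
  mul_mem' ha hb g hg := by rw [map_mul, ha g hg, hb g hg]
  add_mem' ha hb g hg := by rw [map_add, ha g hg, hb g hg]
  algebraMap_mem' r g _ := AlgHom.commutes (act g) r

/-- The degree `n` component of `F[V]`: the span of all products of `n` linear forms. -/
def homogeneousPart (F : Type*) [Field F] (V : Type*) [AddCommGroup V] [Module F V] (n : ℕ) :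
    Submodule F (PolyFun F V) :=
  LinearMap.range (SymmetricAlgebra.ι F (Module.Dual F V)) ^ n

/-- An ideal of `F[V]^G` is homogeneous if it is generated by homogeneous invariants. -/
def IsHomogeneousIdeal {G : Subgroup (LinearMap.GeneralLinearGroup F V)}
    (I : Ideal (invariantRing G)) : Prop :=
  ∃ s : Set (invariantRing G),
    (∀ x ∈ s, ∃ n : ℕ, (x : PolyFun F V) ∈ homogeneousPart F V n) ∧ I = Ideal.span s

variable (F V) in
/-- The polynomial `∏_{φ ∈ V^*} (X + φ)` over `F[V]`. It is used for `F` finite and `V` finite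
dimensional, so that the product is finite. -/
def dicksonProduct : (PolyFun F V)[X] :=
  ∏ᶠ φ : Module.Dual F V, (X + C (SymmetricAlgebra.ι F (Module.Dual F V) φ))

variable (F V) in
/-- The Dickson polynomial `𝐝_{d,i}` (`0 ≤ i ≤ d = dim V`, `q = |F|`), defined by
`∏_{φ ∈ V^*} (X + φ) = ∑_{i=0}^{d} (-1)^(d-i) 𝐝_{d,i} X^(q^i)`. -/
def dicksonPoly (i : ℕ) : PolyFun F V :=
  (-1) ^ (Module.finrank F V - i) * (dicksonProduct F V).coeff (Nat.card F ^ i)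

theorem map_act_dicksonProduct [Finite F] [FiniteDimensional F V]
    (g : LinearMap.GeneralLinearGroup F V) :
    (dicksonProduct F V).map (act g : PolyFun F V →+* PolyFun F V) = dicksonProduct F V := by
  have : Finite (Module.Dual F V) := Module.finite_of_finite F
  have hb : Function.Bijective
      (LinearMap.dualMap ((g⁻¹ : LinearMap.GeneralLinearGroup F V) : V →ₗ[F] V)) := by
    refine Function.bijective_iff_has_inverse.2
      ⟨LinearMap.dualMap (g : V →ₗ[F] V), fun φ => ?_, fun φ => ?_⟩
    · ext v
      exact congrArg φ (LinearMap.congr_fun g.inv_mul v)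
    · ext v
      exact congrArg φ (LinearMap.congr_fun g.mul_inv v)
  have key := MonoidHom.map_finprod
    (f := fun φ : Module.Dual F V =>
      (X + C (SymmetricAlgebra.ι F (Module.Dual F V) φ) : (PolyFun F V)[X]))
    (Polynomial.mapRingHom (act g : PolyFun F V →+* PolyFun F V) :
      (PolyFun F V)[X] →* (PolyFun F V)[X]) (Set.toFinite _)
  unfold dicksonProduct
  refine key.trans (Eq.trans (finprod_congr fun φ => ?_) (finprod_comp _ hb))
  simp [act]

theorem dicksonPoly_mem_invariantRing [Finite F] [FiniteDimensional F V]
    (G : Subgroup (LinearMap.GeneralLinearGroup F V)) (i : ℕ) :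
    dicksonPoly F V i ∈ invariantRing G := by
  intro g _
  have h := congrArg (fun p => Polynomial.coeff p (Nat.card F ^ i))
    (map_act_dicksonProduct (F := F) (V := V) g)
  simp only [Polynomial.coeff_map] at h
  rw [dicksonPoly, map_mul, map_pow, map_neg, map_one]
  exact congrArg _ h

/-- The Dickson invariant `𝐝_{d,i}` as an element of `F[V]^G`. -/
def dickson [Finite F] [FiniteDimensional F V]
    (G : Subgroup (LinearMap.GeneralLinearGroup F V)) (i : ℕ) : invariantRing G :=
  ⟨dicksonPoly F V i, dicksonPoly_mem_invariantRing G i⟩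

/-- `√(ann H^i_I(A))`. -/
def cohomologicalRadical {A : Type*} [CommRing A] (I : Ideal A) (i : ℕ) : Ideal A :=
  (Module.annihilator A ((localCohomology I i).obj (ModuleCat.of A A))).radical

end ModularInvariants

end

/-! Write `N` for the annihilator of `H^i_I(S)`. The heart of the matter is that `N` is stable under
every higher derivation `P : S → S[X]` (a ring homomorphism with constant term the identity). Indeed
`P` induces an automorphism of `T = S[X]/(X^n)` congruent to the identity modulo the nilpotent `X`,
so it changes the ideal `IT` without changing its radical, hence without changing its local
cohomology. Since `T` is finite free over `S`, annihilators extend from `S` to `T` and contract back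
along `S`-linear forms such as coefficients (`coeff_mem_lcAnnihilator`).

This applies to the operations `φ ↦ φ + φ^(q^k) X`, which commute with `GL(V)` and so restrict to
`S`. Minimal primes of a stable ideal are stable, so each minimal prime `p` of `N` is stable, and so
is a suitable prime `Q` of `R` over `p`. By Serre's theorem
(`ringKrullDim_quotient_of_steenrod_stable`) the dimension of `R/Q` is the codimension in `V^*` of
the space of linear forms in `Q`. As `dim R/Q ≤ dim S/p ≤ d - g`, at least `g` independent linear
forms lie in `Q`. Modulo `Q` the Dickson product is then divisible by `X^(q^g)`, so the first `g`
Dickson invariants lie in `Q ∩ S = p`. Finally `J_i` is the intersection of all such `p`. -/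

noncomputable section

namespace ModularInvariants

open CategoryTheory Limits Opposite

universe u

/-! ### Ext classes as explicit cocycles on a projective resolution. -/

section ExtCocycles

variable {A : Type u} [CommRing A] {X : ModuleCat.{u} A}

/-- The complex `Hom(P, Y)`, viewed in the opposite category. -/
abbrev homComplex (P : ProjectiveResolution X) (Y : ModuleCat.{u} A) :
    ChainComplex (ModuleCat.{u} A)ᵒᵖ ℕ :=
  (((linearYoneda A (ModuleCat.{u} A)).obj Y).rightOp.mapHomologicalComplex _).obj P.complex

/-- The comparison of `Ext` with the cohomology of `Hom(P, Y)`. -/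
def extIso (P : ProjectiveResolution X) (Y : ModuleCat.{u} A) (i : ℕ) :
    ((homComplex P Y).homology i).unop ≅ ((Ext A (ModuleCat.{u} A) i).obj (op X)).obj Y :=
  (P.isoLeftDerivedObj ((linearYoneda A (ModuleCat.{u} A)).obj Y).rightOp i).unop

/-- The cocycle `c : P_i ⟶ Y` represents the class `x` in `Ext^i(X, Y)`. -/
def Represents (P : ProjectiveResolution X) (Y : ModuleCat.{u} A) (i : ℕ)
    (c : P.complex.X i ⟶ Y) (x : ((Ext A (ModuleCat.{u} A) i).obj (op X)).obj Y) : Prop :=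
  ∃ z : ((homComplex P Y).opcycles i).unop,
    ((homComplex P Y).pOpcycles i).unop z = c ∧
      (extIso P Y i).hom (((homComplex P Y).homologyι i).unop z) = x

theorem exists_represents (P : ProjectiveResolution X) (Y : ModuleCat.{u} A) (i : ℕ)
    (x : ((Ext A (ModuleCat.{u} A) i).obj (op X)).obj Y) :
    ∃ c, P.complex.d (i + 1) i ≫ c = 0 ∧ Represents P Y i c x := by
  have hs : Function.Surjective ((homComplex P Y).homologyι i).unop :=
    (ModuleCat.epi_iff_surjective _).1 inferInstance
  obtain ⟨z, hz⟩ := hs ((extIso P Y i).inv x)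
  refine ⟨((homComplex P Y).pOpcycles i).unop z, ?_, z, rfl, ?_⟩
  · have h : (homComplex P Y).d (i + 1) i ≫ (homComplex P Y).pOpcycles i = 0 :=
      HomologicalComplex.d_pOpcycles _ _ _
    have h' := congrArg (fun f => f.unop z) h
    exact h'
  · rw [hz]
    simp

theorem Represents.exists_of_cocycle (P : ProjectiveResolution X) (Y : ModuleCat.{u} A) (i : ℕ)
    (c : P.complex.X i ⟶ Y) (hc : P.complex.d (i + 1) i ≫ c = 0) :
    ∃ x, Represents P Y i c x := by
  -- The complex lives in the opposite category, so its opcycles, a cokernel there, are the module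
  -- of cocycles.
  have hex := (ShortComplex.exact_of_g_is_cokernel
    (ShortComplex.mk ((homComplex P Y).d (i + 1) i) ((homComplex P Y).pOpcycles i)
      (HomologicalComplex.d_pOpcycles _ _ _))
    ((homComplex P Y).opcyclesIsCokernel (i + 1) i (by simp))).unop
  rw [ShortComplex.moduleCat_exact_iff] at hex
  obtain ⟨z, hz⟩ := hex c hc
  exact ⟨_, z, hz, rfl⟩

/-- A class vanishes exactly when its cocycle is a coboundary. For `i = 0` the default value `next 0
= 0` comes with a zero differential, so the criterion correctly becomes `c = 0`. -/
theorem Represents.eq_zero_iff {P : ProjectiveResolution X} {Y : ModuleCat.{u} A} {i : ℕ}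
    {c : P.complex.X i ⟶ Y} {x : ((Ext A (ModuleCat.{u} A) i).obj (op X)).obj Y}
    (h : Represents P Y i c x) :
    x = 0 ↔ ∃ v : P.complex.X ((ComplexShape.down ℕ).next i) ⟶ Y,
      c = P.complex.d i ((ComplexShape.down ℕ).next i) ≫ v := by
  obtain ⟨z, rfl, rfl⟩ := h
  have hex := (ShortComplex.exact_of_f_is_kernel
    (ShortComplex.mk ((homComplex P Y).homologyι i)
      ((homComplex P Y).fromOpcycles i ((ComplexShape.down ℕ).next i)) (by simp))
    ((homComplex P Y).homologyIsKernel i _ rfl)).unop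
  rw [ShortComplex.moduleCat_exact_iff] at hex
  have hinj : Function.Injective ((homComplex P Y).pOpcycles i).unop :=
    (ModuleCat.mono_iff_injective _).1 inferInstance
  have hfac : ∀ v, ((homComplex P Y).pOpcycles i).unop
      (((homComplex P Y).fromOpcycles i ((ComplexShape.down ℕ).next i)).unop v) =
      (P.complex.d i ((ComplexShape.down ℕ).next i) ≫ v : P.complex.X i ⟶ Y) := fun v =>
    congrArg (fun f => f.unop v)
      ((homComplex P Y).p_fromOpcycles i ((ComplexShape.down ℕ).next i))
  constructor
  · intro hx
    have h0 : ((homComplex P Y).homologyι i).unop z = 0 := by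
      have := congrArg (extIso P Y i).inv hx
      simpa using this
    obtain ⟨v, hv⟩ := hex z h0
    exact ⟨v, (congrArg ((homComplex P Y).pOpcycles i).unop hv.symm).trans (hfac v)⟩
  · rintro ⟨v, hv⟩
    have hz : z = ((homComplex P Y).fromOpcycles i ((ComplexShape.down ℕ).next i)).unop v :=
      hinj (hv.trans (hfac v).symm)
    have h0 : ((homComplex P Y).homologyι i).unop z = 0 := by
      rw [hz]
      exact congrArg (fun f => f.unop v) ((homComplex P Y).homologyι_comp_fromOpcycles i _)
    rw [h0, map_zero]

theorem Represents.smul {P : ProjectiveResolution X} {Y : ModuleCat.{u} A} {i : ℕ}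
    {c : P.complex.X i ⟶ Y} {x : ((Ext A (ModuleCat.{u} A) i).obj (op X)).obj Y}
    (h : Represents P Y i c x) (a : A) : Represents P Y i (a • c) (a • x) := by
  obtain ⟨z, rfl, rfl⟩ := h
  exact ⟨a • z, map_smul _ _ _, by rw [map_smul, map_smul]⟩

theorem Represents.map {X' : ModuleCat.{u} A} {P : ProjectiveResolution X}
    {P' : ProjectiveResolution X'} {Y : ModuleCat.{u} A} {i : ℕ}
    {c : P.complex.X i ⟶ Y} {x : ((Ext A (ModuleCat.{u} A) i).obj (op X)).obj Y}
    (h : Represents P Y i c x) (f : X' ⟶ X) (φ : P'.complex ⟶ P.complex)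
    (comm : φ.f 0 ≫ P.π.f 0 = P'.π.f 0 ≫ f) :
    Represents P' Y i (φ.f i ≫ c) (((Ext A (ModuleCat.{u} A) i).map f.op).app Y x) := by
  obtain ⟨z, rfl, rfl⟩ := h
  set F := ((linearYoneda A (ModuleCat.{u} A)).obj Y).rightOp
  refine ⟨(HomologicalComplex.opcyclesMap ((F.mapHomologicalComplex _).map φ) i).unop z, ?_, ?_⟩
  · exact congrArg (fun f => f.unop z)
      (HomologicalComplex.p_opcyclesMap ((F.mapHomologicalComplex _).map φ) i)
  · have h1 := congrArg (fun f => f.unop z)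
      (HomologicalComplex.homologyι_naturality ((F.mapHomologicalComplex _).map φ) i)
    have h2 := congrArg (fun g => g.unop (((homComplex P Y).homologyι i).unop z))
      (ProjectiveResolution.isoLeftDerivedObj_hom_naturality f P' P φ comm F i)
    exact (congrArg (extIso P' Y i).hom h1.symm).trans h2.symm

end ExtCocycles

end ModularInvariants

end

noncomputable section

namespace ModularInvariants

open CategoryTheory Limits Opposite

universe u

/-! ### Annihilators of local cohomology in terms of the direct system of Ext modules. -/

section Annihilator

variable {A : Type u} [CommRing A]

/-- The projection `A/I^m → A/I^n` for `n ≤ m`. -/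
abbrev quotPowMap (I : Ideal A) {n m : ℕ} (h : n ≤ m) :
    ModuleCat.of A (A ⧸ I ^ m) ⟶ ModuleCat.of A (A ⧸ I ^ n) :=
  (localCohomology.ringModIdeals (localCohomology.idealPowersDiagram I)).map (homOfLE h).op

/-- Local cohomology is the filtered colimit of `Ext^i(A/I^n, M)`: every element comes from a finite
stage, and what vanishes in the colimit vanishes at a later stage. -/
theorem mem_annihilator_localCohomology_iff (I : Ideal A) (i : ℕ) (M : ModuleCat.{u} A) (a : A) :
    a ∈ Module.annihilator A ((localCohomology I i).obj M) ↔
      ∀ (n : ℕ) (x : ((Ext A (ModuleCat.{u} A) i).obj (op (ModuleCat.of A (A ⧸ I ^ n)))).obj M),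
        ∃ (m : ℕ) (h : n ≤ m),
          a • ((Ext A (ModuleCat.{u} A) i).map (quotPowMap I h).op).app M x = 0 := by
  let D := localCohomology.diagram (localCohomology.idealPowersDiagram I) i
  have := localCohomology.hasColimitDiagram.{u, 0} (localCohomology.idealPowersDiagram I) i
  have hc := isColimitOfPreserves ((evaluation (ModuleCat.{u} A) (ModuleCat.{u} A)).obj M)
    (colimit.isColimit D)
  have : PreservesFilteredColimitsOfSize.{0, 0} (forget (ModuleCat.{u} A)) :=
    preservesFilteredColimitsOfSize_shrink.{0, u, 0, u} _
  rw [Module.mem_annihilator]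
  constructor
  · intro ha n x
    have h0 := ha ((colimit.ι D (op (op n))).app M x)
    have h0' := (map_smul ((colimit.ι D (op (op n))).app M).hom a x).trans h0
    have h1 := (Concrete.isColimit_rep_eq_iff_exists _ hc (i := op (op n)) (j := op (op n))
      (a • x) 0).1 (h0'.trans (map_zero ((colimit.ι D (op (op n))).app M).hom).symm)
    obtain ⟨k, f, g, hfg⟩ := h1
    refine ⟨unop (unop k), leOfHom f.unop.unop, ?_⟩
    rw [← map_smul]
    refine hfg.trans ?_
    exact map_zero _
  · intro h y
    obtain ⟨j, x, rfl⟩ := Concrete.isColimit_exists_rep _ hc y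
    obtain ⟨m, hm, h0⟩ := h (unop (unop j)) x
    have hw := congrArg (fun f => (f.app M) x)
      (colimit.w D (show j ⟶ op (op m) from (homOfLE hm).op.op))
    refine (congrArg (a • ·) hw.symm).trans ?_
    have := map_smul ((colimit.ι D (op (op m))).app M).hom a
      (((Ext A (ModuleCat.{u} A) i).map (quotPowMap I hm).op).app M x)
    refine this.symm.trans ?_
    rw [h0]
    exact map_zero _

end Annihilator

end ModularInvariants

end

noncomputable section

namespace ModularInvariants

open CategoryTheory Limits Opposite TensorProduct

universe u

/-! ### Extension of scalars of the quotients `A/I^n` and of their resolutions. -/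

section BaseChange

variable {A B : Type u} [CommRing A] [CommRing B] (f : A →+* B)

instance extendScalars_additive : (ModuleCat.extendScalars.{u, u, u} f).Additive :=
  (ModuleCat.extendRestrictScalarsAdj f).left_adjoint_additive

instance extendScalars_preservesProjectiveObjects :
    (ModuleCat.extendScalars.{u, u, u} f).PreservesProjectiveObjects :=
  Functor.preservesProjectiveObjects_of_adjunction_of_preservesEpimorphisms
    (ModuleCat.extendRestrictScalarsAdj f)

variable {f} in
theorem extendScalars_preservesHomology (hf : f.Flat) :
    (ModuleCat.extendScalars.{u, u, u} f).PreservesHomology := by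
  have := ModuleCat.preservesFiniteLimits_extendScalars_of_flat hf
  infer_instance

/-- `B ⊗ A/I^n` is `B/(IB)^n`. -/
def extendScalarsQuotIso (I : Ideal A) (n : ℕ) :
    (ModuleCat.extendScalars.{u, u, u} f).obj (ModuleCat.of A (A ⧸ I ^ n)) ≅
      ModuleCat.of B (B ⧸ (I.map f) ^ n) :=
  letI := f.toAlgebra
  (show ModuleCat.of B (B ⊗[A] (A ⧸ I ^ n)) ≅ ModuleCat.of B (B ⧸ (I.map f) ^ n) from
    ((Submodule.quotEquivOfEq _ _ (Ideal.map_pow f I n).symm).trans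
      (Algebra.TensorProduct.quotIdealMapEquivTensorQuot B (I ^ n)).toLinearEquiv).symm.toModuleIso)

theorem extendScalarsQuotIso_naturality (I : Ideal A) {n m : ℕ} (h : n ≤ m) :
    (ModuleCat.extendScalars.{u, u, u} f).map (quotPowMap I h) ≫ (extendScalarsQuotIso f I n).hom =
      (extendScalarsQuotIso f I m).hom ≫ quotPowMap (I.map f) h := by
  -- By adjunction it suffices to compare the two maps on `A/I^m`, where both send the class of `a`
  -- to the class of `f a`.
  apply ((ModuleCat.extendRestrictScalarsAdj f).homEquiv _ _).injective
  refine ModuleCat.hom_ext (LinearMap.ext fun x => ?_)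
  obtain ⟨a, rfl⟩ := Ideal.Quotient.mk_surjective x
  rfl

theorem mapProjectiveResolution_comm {C D : Type*} [Category* C] [Category* D] [HasZeroObject C]
    [Preadditive C] [HasZeroObject D] [Preadditive D] [CategoryWithHomology D] (F : C ⥤ D)
    [F.Additive] [F.PreservesProjectiveObjects] [F.PreservesHomology] {X Y : C} (f : X ⟶ Y)
    (P : ProjectiveResolution X) (Q : ProjectiveResolution Y) (φ : P.complex ⟶ Q.complex)
    (comm : φ.f 0 ≫ Q.π.f 0 = P.π.f 0 ≫ f) :
    ((F.mapHomologicalComplex _).map φ).f 0 ≫ (F.mapProjectiveResolution Q).π.f 0 =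
      (F.mapProjectiveResolution P).π.f 0 ≫ F.map f := by
  have hπ : ∀ {Z : C} (P : ProjectiveResolution Z),
      (F.mapProjectiveResolution P).π.f 0 = F.map (P.π.f 0) := fun P => by
    simp only [Functor.mapProjectiveResolution_π]
    simp
    exact Category.comp_id _
  rw [hπ, hπ]
  exact (F.map_comp _ _).symm.trans ((congrArg F.map comm).trans (F.map_comp _ _))

theorem represents_smul_eq_zero_iff {X : ModuleCat.{u} A} {P : ProjectiveResolution X}
    {Y : ModuleCat.{u} A} {i : ℕ} {c : P.complex.X i ⟶ Y}
    {x : ((Ext A (ModuleCat.{u} A) i).obj (op X)).obj Y} (h : Represents P Y i c x) (a : A) :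
    a • x = 0 ↔ ∃ v : P.complex.X ((ComplexShape.down ℕ).next i) ⟶ Y,
      a • c = P.complex.d i ((ComplexShape.down ℕ).next i) ≫ v :=
  (h.smul a).eq_zero_iff

theorem ext_map_quotPowMap_trans (I : Ideal A) (i : ℕ) (Y : ModuleCat.{u} A) {n m k : ℕ}
    (h : n ≤ m) (h' : m ≤ k)
    (x : ((Ext A (ModuleCat.{u} A) i).obj (op (ModuleCat.of A (A ⧸ I ^ n)))).obj Y) :
    ((Ext A (ModuleCat.{u} A) i).map (quotPowMap I (h.trans h')).op).app Y x =
      ((Ext A (ModuleCat.{u} A) i).map (quotPowMap I h').op).app Y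
        (((Ext A (ModuleCat.{u} A) i).map (quotPowMap I h).op).app Y x) := by
  have h1 : quotPowMap I (h.trans h') = quotPowMap I h' ≫ quotPowMap I h :=
    Functor.map_comp _ (homOfLE h').op (homOfLE h).op
  rw [h1, op_comp, Functor.map_comp, NatTrans.comp_app]
  rfl

/-- Allows the system `B ⊗ A/I^n`, resolved by base change from `A` in the flat case, to replace
`B/(IB)^n`; the next lemma is the converse. -/
theorem mem_annihilator_of_extendScalars {I : Ideal A} {i : ℕ} {b : B} {Y : ModuleCat.{u} B}
    (H : ∀ (n : ℕ) (x : ((Ext B (ModuleCat.{u} B) i).obj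
        (op ((ModuleCat.extendScalars.{u, u, u} f).obj (ModuleCat.of A (A ⧸ I ^ n))))).obj Y),
      ∃ (m : ℕ) (h : n ≤ m), b • ((Ext B (ModuleCat.{u} B) i).map
        ((ModuleCat.extendScalars.{u, u, u} f).map (quotPowMap I h)).op).app Y x = 0) :
    b ∈ Module.annihilator B ((localCohomology (I.map f) i).obj Y) := by
  rw [mem_annihilator_localCohomology_iff]
  intro n x
  obtain ⟨m, h, hm⟩ := H n
    (((Ext B (ModuleCat.{u} B) i).map (extendScalarsQuotIso f I n).hom.op).app Y x)
  refine ⟨m, h, ?_⟩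
  have hinj : Function.Injective
      (((Ext B (ModuleCat.{u} B) i).map (extendScalarsQuotIso f I m).hom.op).app Y) :=
    (((Ext B (ModuleCat.{u} B) i).mapIso
      (extendScalarsQuotIso f I m).op).app Y).toLinearEquiv.injective
  apply hinj
  have hnat := congrArg (fun g => ((Ext B (ModuleCat.{u} B) i).map g.op).app Y x)
    (extendScalarsQuotIso_naturality f I h)
  simp only [op_comp, Functor.map_comp, NatTrans.comp_app, ModuleCat.comp_apply] at hnat
  rw [map_smul, ← hnat, hm, map_zero]

theorem exists_ext_smul_eq_zero_of_mem_annihilator_map {I : Ideal A} {i : ℕ} {b : B}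
    {Y : ModuleCat.{u} B}
    (hb : b ∈ Module.annihilator B ((localCohomology (I.map f) i).obj Y)) (n : ℕ)
    (x : ((Ext B (ModuleCat.{u} B) i).obj
        (op ((ModuleCat.extendScalars.{u, u, u} f).obj (ModuleCat.of A (A ⧸ I ^ n))))).obj Y) :
    ∃ (m : ℕ) (h : n ≤ m), b • ((Ext B (ModuleCat.{u} B) i).map
        ((ModuleCat.extendScalars.{u, u, u} f).map (quotPowMap I h)).op).app Y x = 0 := by
  rw [mem_annihilator_localCohomology_iff] at hb
  obtain ⟨m, h, hm⟩ := hb n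
    (((Ext B (ModuleCat.{u} B) i).map (extendScalarsQuotIso f I n).inv.op).app Y x)
  refine ⟨m, h, ?_⟩
  have hinj : Function.Injective
      (((Ext B (ModuleCat.{u} B) i).map (extendScalarsQuotIso f I m).inv.op).app Y) :=
    (((Ext B (ModuleCat.{u} B) i).mapIso
      (extendScalarsQuotIso f I m).symm.op).app Y).toLinearEquiv.injective
  apply hinj
  have hnat' : quotPowMap (I.map f) h ≫ (extendScalarsQuotIso f I n).inv =
      (extendScalarsQuotIso f I m).inv ≫
        (ModuleCat.extendScalars.{u, u, u} f).map (quotPowMap I h) := by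
    rw [Iso.comp_inv_eq, Category.assoc, Iso.eq_inv_comp, extendScalarsQuotIso_naturality]
  have hnat := congrArg (fun g => ((Ext B (ModuleCat.{u} B) i).map g.op).app Y x) hnat'
  simp only [op_comp, Functor.map_comp, NatTrans.comp_app, ModuleCat.comp_apply] at hnat
  rw [map_smul, ← hnat, hm, map_zero]

end BaseChange

end ModularInvariants

end

noncomputable section

namespace ModularInvariants

open CategoryTheory Limits Opposite TensorProduct

universe u

/-! ### Extension and contraction of annihilators along flat homomorphisms. -/

section BaseChangeAnnihilator

variable {A B : Type u} [CommRing A] [CommRing B] (f : A →+* B)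

theorem extendScalars_homEquiv_smul {M : ModuleCat.{u} A} {Y : ModuleCat.{u} B} (a : A)
    (c : (ModuleCat.extendScalars.{u, u, u} f).obj M ⟶ Y) :
    (ModuleCat.extendRestrictScalarsAdj f).homEquiv M Y (f a • c) =
      a • (ModuleCat.extendRestrictScalarsAdj f).homEquiv M Y c :=
  rfl

/-- Annihilators of local cohomology extend along finite projective ring homomorphisms. -/
theorem map_mem_annihilator_localCohomology (hf : f.Flat) {I : Ideal A} {i : ℕ} {a : A}
    (ha : a ∈ Module.annihilator A ((localCohomology I i).obj (ModuleCat.of A A)))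
    {r : ℕ} (p : Fin r → ((ModuleCat.restrictScalars f).obj (ModuleCat.of B B) ⟶ ModuleCat.of A A))
    (e : Fin r → (ModuleCat.of A A ⟶ (ModuleCat.restrictScalars f).obj (ModuleCat.of B B)))
    (hpe : ∑ k, p k ≫ e k = 𝟙 _) :
    f a ∈ Module.annihilator B ((localCohomology (I.map f) i).obj (ModuleCat.of B B)) := by
  have := extendScalars_preservesHomology hf
  rw [mem_annihilator_localCohomology_iff] at ha
  apply mem_annihilator_of_extendScalars
  intro n x
  let E := ModuleCat.extendScalars.{u, u, u} f
  let adj := ModuleCat.extendRestrictScalarsAdj.{u, u, u} f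
  let P : ∀ n, ProjectiveResolution (ModuleCat.of A (A ⧸ I ^ n)) := fun n => projectiveResolution _
  obtain ⟨c', hc', hx⟩ := exists_represents (E.mapProjectiveResolution (P n)) _ i x
  -- The adjunction turns a `B`-valued cocycle on the extended resolution into an `A`-linear one on
  -- `P n`; its components under the dual basis `p`, `e` are cocycles with values in `A`.
  let c := adj.homEquiv ((P n).complex.X i) (ModuleCat.of B B) c'
  have hc : (P n).complex.d (i + 1) i ≫ c = 0 := by
    have h := congrArg (adj.homEquiv _ _) hc'
    have h1 := adj.homEquiv_naturality_left ((P n).complex.d (i + 1) i) c'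
    exact h1.symm.trans (h.trans rfl)
  have hck : ∀ k, ∃ xk, Represents (P n) (ModuleCat.of A A) i (c ≫ p k) xk := fun k =>
    Represents.exists_of_cocycle _ _ _ _ (by rw [← Category.assoc, hc, zero_comp])
  choose xk hxk using hck
  choose mk hmk h0 using fun k => ha n (xk k)
  -- A common stage beyond `n` and all the `mk k`.
  let m := n + ∑ k, mk k
  have hnm : n ≤ m := Nat.le_add_right _ _
  have hm : ∀ k, mk k ≤ m := fun k =>
    (Finset.single_le_sum (fun _ _ => Nat.zero_le _) (Finset.mem_univ k)).trans
      (Nat.le_add_left _ _)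
  have h1 : ∀ k, a • ((Ext A (ModuleCat.{u} A) i).map (quotPowMap I hnm).op).app _ (xk k) = 0 := by
    intro k
    rw [ext_map_quotPowMap_trans I i _ (hmk k) (hm k), ← map_smul, h0, map_zero]
  let φ := ProjectiveResolution.lift (quotPowMap I hnm) (P m) (P n)
  have hφ : φ.f 0 ≫ (P n).π.f 0 = (P m).π.f 0 ≫ quotPowMap I hnm :=
    ProjectiveResolution.lift_commutes_zero _ _ _
  have h2 := fun k => (represents_smul_eq_zero_iff ((hxk k).map _ φ hφ) a).1 (h1 k)
  choose v hv using h2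
  refine ⟨m, hnm, ?_⟩
  rw [represents_smul_eq_zero_iff
    (hx.map (P' := E.mapProjectiveResolution (P m)) _ ((E.mapHomologicalComplex _).map φ)
      (mapProjectiveResolution_comm E _ _ _ φ hφ))]
  refine ⟨(adj.homEquiv _ _).symm (∑ k, v k ≫ e k), ?_⟩
  apply (adj.homEquiv _ _).injective
  have hL : adj.homEquiv _ _ (f a • (E.map (φ.f i) ≫ c')) = a • (φ.f i ≫ c) :=
    (extendScalars_homEquiv_smul f a _).trans
      (congrArg (a • ·) (adj.homEquiv_naturality_left (φ.f i) c'))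
  have hR : adj.homEquiv _ _ (E.map ((P m).complex.d i ((ComplexShape.down ℕ).next i)) ≫
      (adj.homEquiv _ _).symm (∑ k, v k ≫ e k)) =
      (P m).complex.d i ((ComplexShape.down ℕ).next i) ≫ ∑ k, v k ≫ e k := by
    rw [adj.homEquiv_naturality_left, Equiv.apply_symm_apply]
  refine hL.trans (Eq.trans ?_ hR.symm)
  have h3 : c = ∑ k, (c ≫ p k) ≫ e k := by
    simp_rw [Category.assoc]
    rw [← Preadditive.comp_sum, hpe, Category.comp_id]
  rw [h3, Preadditive.comp_sum, Preadditive.comp_sum, Finset.smul_sum]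
  refine Finset.sum_congr rfl fun k _ => ?_
  rw [← Category.assoc _ (v k), ← hv k, Linear.smul_comp]
  simp only [Category.assoc]

/-- Linear forms on a flat extension contract annihilators of local cohomology. -/
theorem apply_mem_annihilator_localCohomology (hf : f.Flat) {I : Ideal A} {i : ℕ} {b : B}
    (hb : b ∈ Module.annihilator B ((localCohomology (I.map f) i).obj (ModuleCat.of B B)))
    (p : (ModuleCat.restrictScalars f).obj (ModuleCat.of B B) ⟶ ModuleCat.of A A) :
    (p b : A) ∈ Module.annihilator A ((localCohomology I i).obj (ModuleCat.of A A)) := by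
  have := extendScalars_preservesHomology hf
  rw [mem_annihilator_localCohomology_iff]
  intro n x
  let E := ModuleCat.extendScalars.{u, u, u} f
  let adj := ModuleCat.extendRestrictScalarsAdj.{u, u, u} f
  let P : ∀ n, ProjectiveResolution (ModuleCat.of A (A ⧸ I ^ n)) := fun n => projectiveResolution _
  let s : ModuleCat.of A A ⟶ (ModuleCat.restrictScalars f).obj (ModuleCat.of B B) :=
    ModuleCat.ofHom (Y := (ModuleCat.restrictScalars f).obj (ModuleCat.of B B))
      { toFun := fun a => f a
        map_add' := map_add f
        map_smul' := fun a a' => map_mul f a a' }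
  obtain ⟨c, hc, hx⟩ := exists_represents (P n) _ i x
  -- The `A`-valued cocycle is pushed into `B`, where `b` makes it a coboundary. Applying `p`
  -- returns to `A`, because `p (b * f t) = t * p b`.
  let c' := (adj.homEquiv ((P n).complex.X i) (ModuleCat.of B B)).symm (c ≫ s)
  have hc' : E.map ((P n).complex.d (i + 1) i) ≫ c' = 0 := by
    apply (adj.homEquiv _ _).injective
    rw [adj.homEquiv_naturality_left, Equiv.apply_symm_apply, ← Category.assoc, hc, zero_comp]
    rfl
  obtain ⟨x', hx'⟩ := Represents.exists_of_cocycle (E.mapProjectiveResolution (P n)) _ i c' hc'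
  obtain ⟨m, h, h0⟩ := exists_ext_smul_eq_zero_of_mem_annihilator_map f hb n x'
  refine ⟨m, h, ?_⟩
  let φ := ProjectiveResolution.lift (quotPowMap I h) (P m) (P n)
  have hφ : φ.f 0 ≫ (P n).π.f 0 = (P m).π.f 0 ≫ quotPowMap I h :=
    ProjectiveResolution.lift_commutes_zero _ _ _
  rw [represents_smul_eq_zero_iff
    (hx'.map (P' := E.mapProjectiveResolution (P m)) _ ((E.mapHomologicalComplex _).map φ)
      (mapProjectiveResolution_comm E _ _ _ φ hφ))] at h0
  obtain ⟨v, hv⟩ := h0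
  rw [represents_smul_eq_zero_iff (hx.map _ φ hφ)]
  refine ⟨adj.homEquiv ((P m).complex.X ((ComplexShape.down ℕ).next i)) (ModuleCat.of B B) v ≫ p, ?_⟩
  have h1 := congrArg (adj.homEquiv ((P m).complex.X i) (ModuleCat.of B B)) hv
  have hR : adj.homEquiv _ _ (E.map ((P m).complex.d i ((ComplexShape.down ℕ).next i)) ≫ v) =
      (P m).complex.d i ((ComplexShape.down ℕ).next i) ≫ adj.homEquiv _ _ v :=
    adj.homEquiv_naturality_left _ _
  rw [← Category.assoc, ← hR]
  refine Eq.trans ?_ (congrArg (· ≫ p) h1)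
  refine ModuleCat.hom_ext (LinearMap.ext fun y => ?_)
  have hL : adj.homEquiv _ _ (E.map (φ.f i) ≫ c') = φ.f i ≫ c ≫ s := by
    rw [adj.homEquiv_naturality_left, Equiv.apply_symm_apply]
  have hLy : (adj.homEquiv _ _ (E.map (φ.f i) ≫ c')) y = f (c (φ.f i y)) := by
    rw [hL]; rfl
  have h2 : (adj.homEquiv _ _ (b • (E.map (φ.f i) ≫ c'))) y = (b * f (c (φ.f i y)) : B) :=
    congrArg (b * ·) hLy
  refine Eq.trans ?_ (congrArg p h2).symm
  let b' : (ModuleCat.restrictScalars f).obj (ModuleCat.of B B) := b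
  let t : A := c (φ.f i y)
  have h3 : p (t • b') = t • p b' := map_smul p.hom t b'
  have h4 : t • b' = (b * f t : B) := mul_comm (f t) b
  rw [h4] at h3
  exact (mul_comm _ _).trans h3.symm

end BaseChangeAnnihilator

end ModularInvariants

end

noncomputable section

namespace ModularInvariants

open CategoryTheory

universe u

/-! ### Stability of annihilators under higher derivations. -/

section HasseSchmidt

variable {A B : Type u} [CommRing A] [CommRing B]

/-- The annihilator of `H^i_I(A)`. -/
abbrev lcAnnihilator (I : Ideal A) (i : ℕ) : Ideal A :=
  Module.annihilator A ((localCohomology I i).obj (ModuleCat.of A A))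

/-- Writing `B` as a retract of `A^r` supplies the dual basis needed above. -/
theorem algebraMap_mem_lcAnnihilator [Algebra A B] [Module.Finite A B] [Module.Projective A B]
    {I : Ideal A} {i : ℕ} {a : A} (ha : a ∈ lcAnnihilator I i) :
    algebraMap A B a ∈ lcAnnihilator (I.map (algebraMap A B)) i := by
  obtain ⟨r, s, t, -, -, hst⟩ := Module.Finite.exists_comp_eq_id_of_projective A B
  have hflat : (algebraMap A B).Flat := (RingHom.flat_algebraMap_iff).2 inferInstance
  refine map_mem_annihilator_localCohomology (algebraMap A B) hflat ha (r := r)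
    (fun k => ModuleCat.ofHom
      (X := (ModuleCat.restrictScalars (algebraMap A B)).obj (ModuleCat.of B B))
      { toFun := fun b : B => t b k
        map_add' := fun b b' : B => congrFun (map_add t b b') k
        map_smul' := fun a (b : B) => by
          change t (algebraMap A B a * b) k = a * t b k
          rw [← Algebra.smul_def, map_smul]
          rfl })
    (fun k => ModuleCat.ofHom
      (Y := (ModuleCat.restrictScalars (algebraMap A B)).obj (ModuleCat.of B B))
      { toFun := fun a : A => (s (Pi.single k a) : B)
        map_add' := fun b b' => by rw [Pi.single_add, map_add]; rfl
        map_smul' := fun a b => by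
          change s (Pi.single k (a * b)) = algebraMap A B a * s (Pi.single k b)
          rw [← Algebra.smul_def, ← map_smul, ← Pi.single_smul]
          rfl }) ?_
  refine ModuleCat.hom_ext (LinearMap.ext fun b => ?_)
  rw [ModuleCat.hom_sum, LinearMap.sum_apply]
  change ∑ k, s (Pi.single k (t b k)) = b
  rw [← map_sum, Finset.univ_sum_single]
  exact LinearMap.congr_fun hst b

theorem linearMap_apply_mem_lcAnnihilator [Algebra A B] [Module.Flat A B] {I : Ideal A} {i : ℕ}
    {b : B} (hb : b ∈ lcAnnihilator (I.map (algebraMap A B)) i) (p : B →ₗ[A] A) :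
    p b ∈ lcAnnihilator I i :=
  apply_mem_annihilator_localCohomology (algebraMap A B)
    ((RingHom.flat_algebraMap_iff).2 inferInstance) hb
    (ModuleCat.ofHom (X := (ModuleCat.restrictScalars (algebraMap A B)).obj (ModuleCat.of B B))
      { toFun := fun b : B => p b
        map_add' := fun b b' : B => map_add p b b'
        map_smul' := fun a (b : B) => by
          change p (algebraMap A B a * b) = a * p b
          rw [← Algebra.smul_def, map_smul]
          rfl })

theorem ringEquiv_apply_mem_lcAnnihilator (e : A ≃+* B) {I : Ideal A} {i : ℕ} {a : A}
    (ha : a ∈ lcAnnihilator I i) : e a ∈ lcAnnihilator (I.map (e : A →+* B)) i := by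
  let := (e : A →+* B).toAlgebra
  let l : A ≃ₗ[A] B :=
    { e with map_smul' := fun x y => map_mul e x y }
  have : Module.Finite A B := Module.Finite.equiv l
  have : Module.Projective A B := Module.Projective.of_equiv l
  exact algebraMap_mem_lcAnnihilator ha

theorem lcAnnihilator_eq_of_radical_eq [IsNoetherianRing A] {I J : Ideal A}
    (h : I.radical = J.radical) (i : ℕ) : lcAnnihilator I i = lcAnnihilator J i :=
  ((localCohomology.isoOfSameRadical h i).app (ModuleCat.of A A)).toLinearEquiv.annihilator_eq

open Polynomial

/-- The endomorphism of `A[X]/(X^n)` which is a given ring homomorphism `A → A[X]` on `A` and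
fixes `X`. -/
def truncatedExtension (P : A →+* A[X]) (n : ℕ) :
    AdjoinRoot (X ^ n : A[X]) →+* AdjoinRoot (X ^ n : A[X]) :=
  AdjoinRoot.lift ((AdjoinRoot.mk _).comp P) (AdjoinRoot.root _) (by
    have := AdjoinRoot.eval₂_root (X ^ n : A[X])
    simpa using this)

theorem root_dvd_truncatedExtension_sub {P : A →+* A[X]} (hP : ∀ a, (P a).coeff 0 = a) (n : ℕ)
    (t : AdjoinRoot (X ^ n : A[X])) :
    AdjoinRoot.root (X ^ n : A[X]) ∣ truncatedExtension P n t - t := by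
  obtain ⟨q, rfl⟩ := AdjoinRoot.mk_surjective t
  induction q using Polynomial.induction_on' with
  | add p q hp hq =>
    rw [map_add, map_add, add_sub_add_comm]
    exact dvd_add hp hq
  | monomial k a =>
    have h1 : X ∣ P a - C a := by
      rw [X_dvd_iff, coeff_sub, hP, coeff_C_zero, sub_self]
    have h2 := map_dvd (AdjoinRoot.mk (X ^ n : A[X])) h1
    rw [← C_mul_X_pow_eq_monomial, map_mul, map_mul, map_pow, map_pow, AdjoinRoot.mk_X]
    have h3 : truncatedExtension P n (AdjoinRoot.root _) = AdjoinRoot.root _ :=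
      AdjoinRoot.lift_root _
    have h4 : truncatedExtension P n (AdjoinRoot.mk _ (C a)) = AdjoinRoot.mk _ (P a) :=
      AdjoinRoot.lift_of _
    rw [h3, h4, ← sub_mul, ← map_sub]
    exact Dvd.dvd.mul_right h2 _

/-- The difference `N` from the identity raises the `X`-adic order by one, so it is nilpotent and `N
+ 1` is invertible. -/
theorem truncatedExtension_bijective {P : A →+* A[X]} (hP : ∀ a, (P a).coeff 0 = a) (n : ℕ) :
    Function.Bijective (truncatedExtension P n) := by
  let T := AdjoinRoot (X ^ n : A[X])
  let N : AddMonoid.End T := (truncatedExtension P n).toAddMonoidHom - AddMonoidHom.id T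
  have hroot : (AdjoinRoot.root (X ^ n : A[X])) ^ n = 0 := by
    rw [← AdjoinRoot.mk_X, ← map_pow, AdjoinRoot.mk_self]
  have h3 : truncatedExtension P n (AdjoinRoot.root _) = AdjoinRoot.root _ :=
    AdjoinRoot.lift_root _
  have hN : ∀ k t, (AdjoinRoot.root (X ^ n : A[X])) ^ k ∣ (N ^ k) t := by
    intro k
    induction k with
    | zero => intro t; simp
    | succ k ih =>
      intro t
      obtain ⟨s, hs⟩ := ih t
      obtain ⟨w, hw⟩ := root_dvd_truncatedExtension_sub hP n s
      refine ⟨w, ?_⟩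
      have h5 : (N ^ (k + 1)) t = N ((N ^ k) t) := by
        rw [pow_succ']
        rfl
      rw [h5, hs]
      change truncatedExtension P n (AdjoinRoot.root _ ^ k * s) - AdjoinRoot.root _ ^ k * s = _
      rw [map_mul, map_pow, h3, ← mul_sub, hw, pow_succ, mul_assoc]
  have hnil : IsNilpotent N := by
    refine ⟨n, AddMonoidHom.ext fun t => ?_⟩
    obtain ⟨s, hs⟩ := hN n t
    exact hs.trans (by rw [hroot, zero_mul]; rfl)
  obtain ⟨U, hU⟩ := hnil.isUnit_add_one
  have hval : ∀ t, (U : AddMonoid.End T) t = truncatedExtension P n t := by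
    intro t
    rw [hU]
    exact sub_add_cancel _ _
  have hb : Function.Bijective (U : AddMonoid.End T) := by
    refine Function.bijective_iff_has_inverse.2 ⟨((U⁻¹ : (AddMonoid.End T)ˣ) : AddMonoid.End T),
      fun t => ?_, fun t => ?_⟩
    · exact DFunLike.congr_fun U.inv_mul t
    · exact DFunLike.congr_fun U.mul_inv t
  rwa [show ((U : AddMonoid.End T) : T → T) = truncatedExtension P n from funext hval] at hb

/-- An element and its image differ by a multiple of the nilpotent root, which lies in every radical
ideal. -/
theorem radical_map_truncatedExtension {P : A →+* A[X]} (hP : ∀ a, (P a).coeff 0 = a) (n : ℕ)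
    (K : Ideal (AdjoinRoot (X ^ n : A[X]))) :
    (K.map (truncatedExtension P n)).radical = K.radical := by
  have hroot : ∀ L : Ideal (AdjoinRoot (X ^ n : A[X])), ∀ t,
      AdjoinRoot.root (X ^ n : A[X]) ∣ t → t ∈ L.radical := by
    rintro L t ⟨s, rfl⟩
    refine Ideal.mul_mem_right _ _ ⟨n, ?_⟩
    rw [← AdjoinRoot.mk_X, ← map_pow, AdjoinRoot.mk_self]
    exact L.zero_mem
  apply le_antisymm
  · rw [Ideal.radical_le_radical_iff, Ideal.map_le_iff_le_comap]
    intro t ht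
    rw [Ideal.mem_comap, ← sub_add_cancel (truncatedExtension P n t) t]
    exact add_mem (hroot _ _ (root_dvd_truncatedExtension_sub hP n t)) (Ideal.le_radical ht)
  · rw [Ideal.radical_le_radical_iff]
    intro t ht
    rw [← sub_sub_cancel (truncatedExtension P n t) t]
    exact sub_mem (Ideal.le_radical (Ideal.mem_map_of_mem _ ht))
      (hroot _ _ (root_dvd_truncatedExtension_sub hP n t))

/-- Annihilators of local cohomology of a Noetherian ring are stable under higher derivations. -/
theorem coeff_mem_lcAnnihilator [IsNoetherianRing A] {P : A →+* A[X]}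
    (hP : ∀ a, (P a).coeff 0 = a) {I : Ideal A} {i : ℕ} {a : A} (ha : a ∈ lcAnnihilator I i)
    (j : ℕ) : (P a).coeff j ∈ lcAnnihilator I i := by
  -- The smallest truncation that still sees the coefficient of `X^j`.
  let n := j + 1
  have hmonic : (X ^ n : A[X]).Monic := monic_X_pow n
  have := hmonic.finite_adjoinRoot
  have := hmonic.free_adjoinRoot
  have : IsNoetherianRing (AdjoinRoot (X ^ n : A[X])) := 
    IsNoetherianRing.of_finite A _
  have h1 := algebraMap_mem_lcAnnihilator (B := AdjoinRoot (X ^ n : A[X])) ha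
  have h2 := ringEquiv_apply_mem_lcAnnihilator
    (RingEquiv.ofBijective _ (truncatedExtension_bijective hP n)) h1
  have h3 : truncatedExtension P n (algebraMap A _ a) ∈
      lcAnnihilator (I.map (algebraMap A (AdjoinRoot (X ^ n : A[X])))) i := by
    rw [← lcAnnihilator_eq_of_radical_eq
      (radical_map_truncatedExtension hP n (I.map (algebraMap A (AdjoinRoot (X ^ n : A[X])))))]
    exact h2
  have h4 : truncatedExtension P n (algebraMap A _ a) = AdjoinRoot.mk _ (P a) :=
    AdjoinRoot.lift_of _
  rw [h4] at h3
  have h5 := linearMap_apply_mem_lcAnnihilator h3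
    ((lcoeff A j).comp (AdjoinRoot.modByMonicHom hmonic))
  have h6 : (lcoeff A j).comp (AdjoinRoot.modByMonicHom hmonic) (AdjoinRoot.mk _ (P a)) =
      (P a).coeff j := by
    rw [LinearMap.comp_apply, AdjoinRoot.modByMonicHom_mk, lcoeff_apply]
    conv_rhs => rw [← modByMonic_add_div (P a) (X ^ n)]
    rw [coeff_add, coeff_X_pow_mul', if_neg (by omega), add_zero]
  rwa [h6] at h5

end HasseSchmidt

end ModularInvariants

end

noncomputable section

namespace ModularInvariants

/-! ### Prime ideals of polynomial rings stable under partial derivatives. -/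

section Derivatives

open MvPolynomial

theorem totalDegree_pderiv_lt {σ F : Type*} [CommSemiring F] {f : MvPolynomial σ F} {i : σ}
    (h : pderiv i f ≠ 0) : (pderiv i f).totalDegree < f.totalDegree := by
  have key : ∀ m ∈ (pderiv i f).support, (m.sum fun _ e => e) + 1 ≤ f.totalDegree := by
    intro m hm
    rw [mem_support_iff, coeff_pderiv] at hm
    have h1 : m + Finsupp.single i 1 ∈ f.support := by
      rw [mem_support_iff]
      exact left_ne_zero_of_mul hm
    have h2 := le_totalDegree h1
    rwa [Finsupp.sum_add_index' (fun _ => rfl) (fun _ _ _ => rfl),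
      Finsupp.sum_single_index rfl] at h2
  obtain ⟨m, hm⟩ := Finset.nonempty_iff_ne_empty.2 (mt support_eq_empty.1 h)
  rw [totalDegree, Finset.sup_lt_iff (by have := key m hm; rw [Nat.bot_eq_zero]; omega)]
  intro b hb
  exact key b hb

/-- Over a perfect field of characteristic `p`, a polynomial all of whose partial derivatives
vanish is a `p`-th power. -/
theorem exists_pow_eq_of_pderiv_eq_zero {σ F : Type*} [Field F] (p : ℕ) [Fact p.Prime] [CharP F p]
    [PerfectRing F p] {f : MvPolynomial σ F} (h : ∀ i, pderiv i f = 0) : ∃ g, g ^ p = f := by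
  have hdvd : ∀ m ∈ f.support, ∀ i, p ∣ m i := by
    intro m hm i
    by_cases hi : m i = 0
    · rw [hi]; exact dvd_zero _
    have h1 := congrArg (coeff (m - Finsupp.single i 1)) (h i)
    have h2 : m - Finsupp.single i 1 + Finsupp.single i 1 = m :=
      tsub_add_cancel_of_le (by rw [Finsupp.single_le_iff]; omega)
    rw [coeff_pderiv, h2, coeff_zero] at h1
    have h3 := (mul_eq_zero.1 h1).resolve_left (mem_support_iff.1 hm)
    rw [← CharP.cast_eq_zero_iff F p]
    have h4 : m i = (m - Finsupp.single i 1 : σ →₀ ℕ) i + 1 := by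
      rw [Finsupp.tsub_apply, Finsupp.single_eq_same]
      omega
    rw [h4, Nat.cast_add, Nat.cast_one]
    exact h3
  refine ⟨∑ m ∈ f.support, monomial (m.mapRange (· / p) (Nat.zero_div p))
    ((frobeniusEquiv F p).symm (coeff m f)), ?_⟩
  rw [sum_pow_char]
  conv_rhs => rw [f.as_sum]
  refine Finset.sum_congr rfl fun m hm => ?_
  rw [monomial_pow]
  have h5 : p • m.mapRange (· / p) (Nat.zero_div p) = m := by
    ext i
    simp [Nat.mul_div_cancel' (hdvd m hm i)]
  rw [h5, ← frobenius_def, frobenius_apply_frobeniusEquiv_symm]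

/-- Over a perfect field of positive characteristic, the zero ideal is the only prime ideal of a
polynomial ring which is stable under all partial derivatives. -/
theorem eq_bot_of_pderiv_mem {σ F : Type*} [Field F] (p : ℕ) [Fact p.Prime] [CharP F p]
    [PerfectRing F p] (q : Ideal (MvPolynomial σ F)) [hq : q.IsPrime]
    (h : ∀ f ∈ q, ∀ i, pderiv i f ∈ q) : q = ⊥ := by
  rw [eq_bot_iff]
  have key : ∀ n, ∀ f ∈ q, f.totalDegree = n → f = 0 := by
    intro n
    induction n using Nat.strong_induction_on with
    | _ n ih =>
      intro f hf hn
      -- The derivatives lie in `q` and have smaller degree, so they vanish by induction. Then `f =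
      -- g ^ p` with `g ∈ q`, and `g` has smaller degree unless it is constant.
      have h0 : ∀ i, pderiv i f = 0 := by
        intro i
        by_contra hne
        exact hne (ih _ (hn ▸ totalDegree_pderiv_lt hne) _ (h f hf i) rfl)
      obtain ⟨g, rfl⟩ := exists_pow_eq_of_pderiv_eq_zero p h0
      have hp : p.Prime := Fact.out
      have hg : g ∈ q := hq.mem_of_pow_mem _ hf
      by_cases hd : g.totalDegree = 0
      · rw [totalDegree_eq_zero_iff_eq_C] at hd
        by_contra hne
        have hc : coeff 0 g ≠ 0 := by
          intro hc
          rw [hc, C_0] at hd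
          exact hne (by rw [hd, zero_pow hp.ne_zero])
        rw [hd] at hg
        exact hq.ne_top (q.eq_top_of_isUnit_mem hg ((IsUnit.mk0 _ hc).map C))
      · have hlt : g.totalDegree < n := by
          have hg0 : g ≠ 0 := by
            rintro rfl
            exact hd totalDegree_zero
          obtain ⟨r, rfl⟩ := Nat.exists_eq_add_of_le hp.two_le
          rw [← hn, pow_add, pow_two, mul_assoc, totalDegree_mul_of_isDomain hg0
            (mul_ne_zero hg0 (pow_ne_zero _ hg0)),
            totalDegree_mul_of_isDomain hg0 (pow_ne_zero _ hg0)]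
          omega
        rw [ih _ hlt g hg rfl, zero_pow hp.ne_zero]
  intro f hf
  exact key _ f hf rfl

end Derivatives

/-! ### The Moore determinant. -/

section Moore

open Polynomial

variable {F : Type*} [Field F] [Finite F] {B : Type*} [CommRing B] [Algebra F B]

variable (F B) in
/-- The `k`-th power of the `F`-linear Frobenius `x ↦ x ^ |F|`. -/
def frobPow (k : ℕ) : B →ₐ[F] B :=
  letI := Fintype.ofFinite F
  (FiniteField.frobeniusAlgHom F B) ^ k

@[simp]
theorem frobPow_apply (k : ℕ) (x : B) : frobPow F B k x = x ^ (Nat.card F ^ k) := by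
  let := Fintype.ofFinite F
  rw [Nat.card_eq_fintype_card]
  induction k with
  | zero => simp [frobPow]
  | succ k ih =>
    have h : frobPow F B (k + 1) x = FiniteField.frobeniusAlgHom F B (frobPow F B k x) := by
      unfold frobPow
      rw [pow_succ']
      rfl
    rw [h, ih, FiniteField.coe_frobeniusAlgHom, pow_succ, pow_mul]

/-- The Moore matrix of a linearly independent family over a finite field is nonsingular. -/
theorem det_moore_ne_zero [IsDomain B] {n : ℕ} {y : Fin n → B} (hy : LinearIndependent F y) :
    (Matrix.of fun k i : Fin n => y i ^ (Nat.card F ^ (k : ℕ))).det ≠ 0 := by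
  rw [Ne, ← Matrix.exists_vecMul_eq_zero_iff]
  rintro ⟨v, hv, h0⟩
  let := Fintype.ofFinite F
  have hq : 1 < Nat.card F := Finite.one_lt_card
  -- A relation `v` between the rows gives an `F`-linear polynomial of degree below `q^n` that
  -- vanishes on the `q^n` elements of the span of `y`.
  let p : B[X] := ∑ k : Fin n, C (v k) * X ^ (Nat.card F ^ (k : ℕ))
  have hp : p = 0 := by
    refine eq_zero_of_natDegree_lt_card_of_eval_eq_zero (ι := Fin n → F) p
      (f := fun a => ∑ i, a i • y i) ?_ ?_ ?_
    · intro a b hab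
      have h1 : ∑ i, (a i - b i) • y i = 0 := by
        simp only [sub_smul, Finset.sum_sub_distrib]
        exact sub_eq_zero.2 hab
      funext i
      exact sub_eq_zero.1 (Fintype.linearIndependent_iff.1 hy _ h1 i)
    · intro a
      have h2 : ∀ k : Fin n, (∑ i, a i • y i) ^ (Nat.card F ^ (k : ℕ)) =
          ∑ i, a i • y i ^ (Nat.card F ^ (k : ℕ)) := by
        intro k
        rw [← frobPow_apply, map_sum]
        simp only [map_smul, frobPow_apply]
      simp only [p, eval_finsetSum, eval_mul, eval_C, eval_pow, eval_X, h2, Finset.mul_sum]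
      rw [Finset.sum_comm]
      refine Finset.sum_eq_zero fun i _ => ?_
      have h3 := congrFun h0 i
      simp only [Matrix.vecMul, dotProduct, Matrix.of_apply, Pi.zero_apply] at h3
      simp only [mul_smul_comm]
      rw [← Finset.smul_sum, h3, smul_zero]
    · rw [Fintype.card_fun, Fintype.card_fin, ← Nat.card_eq_fintype_card]
      have hpos : 0 < Nat.card F ^ n := by positivity
      refine lt_of_le_of_lt (natDegree_sum_le _ _) ?_
      rw [Finset.fold_max_lt]
      refine ⟨hpos, fun k _ => ?_⟩
      exact (natDegree_C_mul_X_pow_le _ _).trans_lt (Nat.pow_lt_pow_right hq k.2)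
  apply hv
  funext k
  have h4 := congrArg (fun f => coeff f (Nat.card F ^ (k : ℕ))) hp
  simp only [p, finsetSum_coeff, coeff_C_mul, coeff_X_pow, coeff_zero] at h4
  rw [Finset.sum_eq_single k] at h4
  · simpa using h4
  · intro l _ hl
    rw [if_neg, mul_zero]
    intro h
    exact hl (Fin.ext (Nat.pow_right_injective hq h).symm)
  · simp

end Moore

end ModularInvariants

end

noncomputable section

namespace ModularInvariants

open Polynomial

/-! ### Steenrod operations on the symmetric algebra and Serre's theorem. -/

section Steenrod

variable {F : Type*} [Field F] {M : Type*} [AddCommGroup M] [Module F M]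

/-- The linear forms in an ideal. -/
def linearForms (Q : Ideal (SymmetricAlgebra F M)) : Submodule F M :=
  (Q.restrictScalars F).comap (SymmetricAlgebra.ι F M)

theorem mem_linearForms {Q : Ideal (SymmetricAlgebra F M)} {m : M} :
    m ∈ linearForms Q ↔ SymmetricAlgebra.ι F M m ∈ Q := Iff.rfl

variable [Finite F]

variable (F M) in
/-- The algebra homomorphism `Sym(M) → Sym(M)[X]` given by `φ ↦ φ + φ ^ (q ^ k) X` on `M`, where
`q = |F|`. For `k = 1` it is the total Steenrod operation. -/
def steenrod (k : ℕ) : SymmetricAlgebra F M →ₐ[F] (SymmetricAlgebra F M)[X] :=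
  SymmetricAlgebra.lift
    ((CAlgHom (R := F)).toLinearMap ∘ₗ SymmetricAlgebra.ι F M +
      (LinearMap.mulRight F (X : (SymmetricAlgebra F M)[X])) ∘ₗ (CAlgHom (R := F)).toLinearMap ∘ₗ
        (frobPow F (SymmetricAlgebra F M) k).toLinearMap ∘ₗ SymmetricAlgebra.ι F M)

@[simp]
theorem steenrod_ι (k : ℕ) (m : M) :
    steenrod F M k (SymmetricAlgebra.ι F M m) =
      C (SymmetricAlgebra.ι F M m) + C (SymmetricAlgebra.ι F M m ^ (Nat.card F ^ k)) * X := by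
  simp [steenrod]

theorem steenrod_coeff_zero (k : ℕ) (r : SymmetricAlgebra F M) :
    (steenrod F M k r).coeff 0 = r := by
  let e : (SymmetricAlgebra F M)[X] →ₐ[F] SymmetricAlgebra F M :=
    (aeval (0 : SymmetricAlgebra F M)).restrictScalars F
  have h : e.comp (steenrod F M k) = AlgHom.id F _ := by
    apply SymmetricAlgebra.algHom_ext
    ext m
    simp [e]
  have h2 := DFunLike.congr_fun h r
  rw [coeff_zero_eq_aeval_zero]
  exact h2

/-- The coefficient of `X` is a derivation raising linear forms to the power `q^k`, so the chain
rule applies. -/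
theorem steenrod_aeval_coeff_one {n : ℕ} (m : Fin n → M) (k : ℕ) (f : MvPolynomial (Fin n) F) :
    (steenrod F M k (MvPolynomial.aeval (fun i => SymmetricAlgebra.ι F M (m i)) f)).coeff 1 =
      ∑ i, SymmetricAlgebra.ι F M (m i) ^ (Nat.card F ^ k) *
        MvPolynomial.aeval (fun i => SymmetricAlgebra.ι F M (m i)) (MvPolynomial.pderiv i f) := by
  induction f using MvPolynomial.induction_on with
  | C a =>
    simp only [MvPolynomial.algHom_C, MvPolynomial.pderiv_C, map_zero, mul_zero,
      Finset.sum_const_zero, AlgHom.commutes, Polynomial.algebraMap_apply]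
    exact coeff_C_succ
  | add p q hp hq =>
    simp only [map_add, coeff_add, hp, hq, mul_add, Finset.sum_add_distrib]
  | mul_X p j hp =>
    have h1 : (C (SymmetricAlgebra.ι F M (m j)) +
        C (SymmetricAlgebra.ι F M (m j) ^ (Nat.card F ^ k)) * X).coeff 1 =
        SymmetricAlgebra.ι F M (m j) ^ (Nat.card F ^ k) := by
      rw [coeff_add, coeff_C_mul, coeff_X_one, mul_one, coeff_C_succ, zero_add]
    rw [map_mul, map_mul, mul_coeff_one, steenrod_coeff_zero, hp, MvPolynomial.aeval_X,
      steenrod_coeff_zero, steenrod_ι, h1]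
    simp only [MvPolynomial.pderiv_mul, map_add, map_mul, MvPolynomial.aeval_X, mul_add,
      Finset.sum_add_distrib]
    rw [add_comm, Finset.sum_mul]
    congr 1
    · refine Finset.sum_congr rfl fun i _ => ?_
      rw [mul_assoc]
    · rw [Finset.sum_eq_single j]
      · rw [MvPolynomial.pderiv_X_self, map_one, mul_one, mul_comm]
      · intro i _ hi
        rw [MvPolynomial.pderiv_X_of_ne hi.symm, map_zero, mul_zero, mul_zero]
      · simp

/-- Serre's theorem: a Steenrod-stable prime ideal of `Sym(M)` is generated by linear forms; here
in the form of its consequence for the dimension. -/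
theorem ringKrullDim_quotient_of_steenrod_stable [FiniteDimensional F M]
    (Q : Ideal (SymmetricAlgebra F M)) [Q.IsPrime]
    (hQ : ∀ k, ∀ r ∈ Q, (steenrod F M k r).coeff 1 ∈ Q) :
    ringKrullDim (SymmetricAlgebra F M ⧸ Q) =
      (Module.finrank F (M ⧸ linearForms Q) : ℕ) := by
  let n := Module.finrank F (M ⧸ linearForms Q)
  let b : Module.Basis (Fin n) F (M ⧸ linearForms Q) := Module.finBasis F _
  choose m hm using fun i => Submodule.Quotient.mk_surjective _ (b i)
  let A := SymmetricAlgebra F M ⧸ Q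
  let y : Fin n → A := fun i => Ideal.Quotient.mk Q (SymmetricAlgebra.ι F M (m i))
  let θ' : MvPolynomial (Fin n) F →ₐ[F] SymmetricAlgebra F M :=
    MvPolynomial.aeval (fun i => SymmetricAlgebra.ι F M (m i))
  let θ : MvPolynomial (Fin n) F →ₐ[F] A := (Ideal.Quotient.mkₐ F Q).comp θ'
  have hlin : ∀ a : Fin n → F, ∑ i, a i • y i =
      Ideal.Quotient.mk Q (SymmetricAlgebra.ι F M (∑ i, a i • m i)) := by
    intro a
    rw [map_sum, map_sum]
    refine Finset.sum_congr rfl fun i _ => ?_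
    rw [map_smul]
    exact (map_smul (Ideal.Quotient.mkₐ F Q) _ _).symm
  have hmk : ∀ a : Fin n → F, Submodule.Quotient.mk (p := linearForms Q) (∑ i, a i • m i) =
      ∑ i, a i • b i := by
    intro a
    rw [← Submodule.mkQ_apply, map_sum]
    refine Finset.sum_congr rfl fun i _ => ?_
    rw [map_smul, Submodule.mkQ_apply, hm]
  have hy : LinearIndependent F y := by
    rw [Fintype.linearIndependent_iff]
    intro a ha
    rw [hlin, Ideal.Quotient.eq_zero_iff_mem, ← mem_linearForms,
      ← Submodule.Quotient.mk_eq_zero, hmk] at ha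
    exact Fintype.linearIndependent_iff.1 b.linearIndependent a ha
  have hsurj : Function.Surjective θ := by
    rw [← AlgHom.range_eq_top, eq_top_iff]
    rintro x -
    obtain ⟨r, rfl⟩ := Ideal.Quotient.mk_surjective x
    induction r using SymmetricAlgebra.induction with
    | algebraMap a => exact θ.range.algebraMap_mem a
    | ι w =>
      let a := b.repr (Submodule.Quotient.mk w)
      have h1 : w - ∑ i, a i • m i ∈ linearForms Q := by
        rw [← Submodule.Quotient.mk_eq_zero, Submodule.Quotient.mk_sub, hmk, b.sum_repr, sub_self]
      have h2 : Ideal.Quotient.mk Q (SymmetricAlgebra.ι F M w) = ∑ i, a i • y i := by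
        rw [hlin, ← sub_eq_zero, ← map_sub, ← map_sub]
        exact Ideal.Quotient.eq_zero_iff_mem.2 h1
      rw [h2]
      have h3 : ∀ i, y i ∈ θ.range := fun i => ⟨MvPolynomial.X i, by simp [θ, θ', y]⟩
      exact Subalgebra.sum_mem _ fun i _ => Subalgebra.smul_mem _ (h3 i) _
    | mul x z hx hz => rw [map_mul]; exact mul_mem hx hz
    | add x z hx hz => rw [map_add]; exact add_mem hx hz
  -- For `f` in the kernel, stability for `k < n` gives a linear system in the `θ (∂_i f)` whose
  -- Moore matrix is nonsingular. So the kernel is stable under all partial derivatives.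
  have hker : RingHom.ker θ = ⊥ := by
    obtain ⟨p, hp⟩ := CharP.exists F
    have : Fact p.Prime := ⟨CharP.char_is_prime F p⟩
    have : (RingHom.ker θ).IsPrime := RingHom.ker_isPrime _
    refine eq_bot_of_pderiv_mem p _ fun f hf => ?_
    have h1 : ∀ k, ∑ i, y i ^ (Nat.card F ^ k) * θ (MvPolynomial.pderiv i f) = 0 := by
      intro k
      have h2 := hQ k (θ' f) (Ideal.Quotient.eq_zero_iff_mem.1 hf)
      rw [steenrod_aeval_coeff_one] at h2
      rw [← Ideal.Quotient.eq_zero_iff_mem, map_sum] at h2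
      simp only [map_mul, map_pow] at h2
      exact h2
    have h3 := Matrix.eq_zero_of_mulVec_eq_zero (det_moore_ne_zero hy)
      (v := fun i => θ (MvPolynomial.pderiv i f)) (funext fun k => h1 k)
    exact fun i => congrFun h3 i
  have e := AlgEquiv.ofBijective θ ⟨(RingHom.injective_iff_ker_eq_bot θ).2 hker, hsurj⟩
  rw [← ringKrullDim_eq_of_ringEquiv e.toRingEquiv, MvPolynomial.ringKrullDim_of_isNoetherianRing,
    ringKrullDim_eq_zero_of_field, zero_add, Nat.card_fin]

end Steenrod

end ModularInvariants

end

noncomputable section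

namespace ModularInvariants

open Polynomial

/-! ### Stable minimal primes and dimension in integral extensions. -/

section HigherDerivations

variable {A : Type*} [CommRing A]

/-- Minimal primes of an ideal stable under a higher derivation are stable. -/
theorem coeff_mem_of_mem_minimalPrimes {P : A →+* A[X]} (hP : ∀ a, (P a).coeff 0 = a)
    {N p : Ideal A} (hN : ∀ a ∈ N, ∀ j, (P a).coeff j ∈ N) (hp : p ∈ N.minimalPrimes) :
    ∀ a ∈ p, ∀ j, (P a).coeff j ∈ p := by
  have : p.IsPrime := hp.1.1
  -- The elements with all coefficients in `p` form a prime between `N` and `p`; minimality makes it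
  -- equal to `p`.
  have hprime : ((p.map C).comap P).IsPrime :=
    Ideal.IsPrime.comap P (hK := Ideal.isPrime_map_C_of_isPrime)
  have hle : (p.map C).comap P ≤ p := by
    intro a ha
    have := Ideal.mem_map_C_iff.1 (Ideal.mem_comap.1 ha) 0
    rwa [hP] at this
  have hN' : N ≤ (p.map C).comap P := fun a ha =>
    Ideal.mem_comap.2 (Ideal.mem_map_C_iff.2 fun j => hp.1.2 (hN a ha j))
  intro a ha
  exact Ideal.mem_map_C_iff.1 (Ideal.mem_comap.1 (hp.2 ⟨hprime, hN'⟩ hle ha))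

/-- Incomparability: contraction of primes along an integral extension is strictly monotone. -/
theorem ringKrullDim_quotient_le_of_isIntegral {B : Type*} [CommRing B] [Algebra A B]
    [Algebra.IsIntegral A B] (Q : Ideal B) :
    ringKrullDim (B ⧸ Q) ≤ ringKrullDim (A ⧸ Q.comap (algebraMap A B)) := by
  refine Order.krullDim_le_of_strictMono
    (PrimeSpectrum.comap (algebraMap (A ⧸ Q.comap (algebraMap A B)) (B ⧸ Q))) fun x y hxy => ?_
  exact Ideal.IsIntegral.comap_lt_comap hxy

end HigherDerivations

/-! ### Rings of invariants and Dickson invariants. -/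

section Invariants

theorem natCard_submodule {F : Type*} [Field F] {M : Type*} [AddCommGroup M] [Module F M]
    [FiniteDimensional F M] (W : Submodule F M) : Nat.card W = Nat.card F ^ Module.finrank F W :=
  Module.natCard_eq_pow_finrank

variable {F : Type*} [Field F] [Finite F] {V : Type*} [AddCommGroup V] [Module F V]

theorem map_act_steenrod (g : LinearMap.GeneralLinearGroup F V) (k : ℕ) (r : PolyFun F V) :
    (steenrod F (Module.Dual F V) k r).map (act g : PolyFun F V →+* PolyFun F V) =
      steenrod F (Module.Dual F V) k (act g r) := by
  have h : (mapAlgHom (act g)).comp (steenrod F (Module.Dual F V) k) =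
      (steenrod F (Module.Dual F V) k).comp (act g) := by
    apply SymmetricAlgebra.algHom_ext
    ext m : 1
    simp [act]
  exact DFunLike.congr_fun h r

variable (G : Subgroup (LinearMap.GeneralLinearGroup F V))

theorem coeff_steenrod_mem_invariantRing (k : ℕ) {r : PolyFun F V} (hr : r ∈ invariantRing G)
    (j : ℕ) : (steenrod F (Module.Dual F V) k r).coeff j ∈ invariantRing G := by
  intro g hg
  have h := congrArg (fun f => coeff f j) (map_act_steenrod g k r)
  rw [hr g hg] at h
  simpa only [coeff_map] using! h

/-- The restriction of `steenrod` to the ring of invariants. -/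
def invariantSteenrod (k : ℕ) : invariantRing G →+* (invariantRing G)[X] :=
  let S := (invariantRing G).toSubring
  let m : S[X] →+* (PolyFun F V)[X] := mapRingHom S.subtype
  have hm : Function.Injective m := map_injective _ Subtype.val_injective
  (RingEquiv.symm (RingEquiv.ofLeftInverse (Function.leftInverse_invFun hm))).toRingHom.comp
    (((steenrod F (Module.Dual F V) k).toRingHom.comp S.subtype).codRestrict m.range fun s =>
      (mem_map_range _).2 fun j =>
        ⟨⟨_, coeff_steenrod_mem_invariantRing G k s.2 j⟩, rfl⟩)

theorem coe_coeff_invariantSteenrod (k : ℕ) (s : invariantRing G) (j : ℕ) :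
    ((invariantSteenrod G k s).coeff j : PolyFun F V) =
      (steenrod F (Module.Dual F V) k s).coeff j := by
  have h : (invariantSteenrod G k s).map (invariantRing G).toSubring.subtype =
      steenrod F (Module.Dual F V) k s := by
    let S := (invariantRing G).toSubring
    let m : S[X] →+* (PolyFun F V)[X] := mapRingHom S.subtype
    have hm : Function.Injective m := map_injective _ Subtype.val_injective
    exact congrArg Subtype.val ((RingEquiv.ofLeftInverse
      (Function.leftInverse_invFun hm)).apply_symm_apply ⟨steenrod F (Module.Dual F V) k s, _⟩)
  rw [← h, coeff_map]
  rfl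

variable [FiniteDimensional F V]

theorem dicksonProduct_monic : (dicksonProduct F V).Monic := by
  have : Finite (Module.Dual F V) := Module.finite_of_finite F
  let := Fintype.ofFinite (Module.Dual F V)
  rw [dicksonProduct, finprod_eq_prod_of_fintype]
  exact monic_prod_of_monic _ _ fun φ _ => monic_X_add_C _

theorem eval_dicksonProduct (φ : Module.Dual F V) :
    (dicksonProduct F V).eval (SymmetricAlgebra.ι F (Module.Dual F V) φ) = 0 := by
  have : Finite (Module.Dual F V) := Module.finite_of_finite F
  let := Fintype.ofFinite (Module.Dual F V)
  rw [dicksonProduct, finprod_eq_prod_of_fintype, eval_prod]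
  exact Finset.prod_eq_zero (Finset.mem_univ (-φ)) (by simp)

/-- The Dickson invariants of small index lie in any ideal containing many linear forms. -/
theorem dicksonPoly_mem (Q : Ideal (PolyFun F V)) {j : ℕ}
    (hj : j < Module.finrank F (linearForms Q)) : dicksonPoly F V j ∈ Q := by
  classical
  have : Finite (Module.Dual F V) := Module.finite_of_finite F
  let := Fintype.ofFinite (Module.Dual F V)
  refine Ideal.mul_mem_left _ _ ?_
  rw [← Ideal.Quotient.eq_zero_iff_mem, ← coeff_map]
  -- Each linear form in `Q` turns its factor of the Dickson product into `X` modulo `Q`.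
  have hdvd : X ^ (Nat.card F ^ Module.finrank F (linearForms Q)) ∣
      (dicksonProduct F V).map (Ideal.Quotient.mk Q) := by
    have hcard : Nat.card (linearForms Q) = Nat.card F ^ Module.finrank F (linearForms Q) :=
      natCard_submodule _
    rw [dicksonProduct, finprod_eq_prod_of_fintype, Polynomial.map_prod, ← hcard]
    have h1 : X ^ Nat.card (linearForms Q) =
        ∏ φ ∈ Finset.univ.filter (· ∈ linearForms Q),
          (X + C (SymmetricAlgebra.ι F (Module.Dual F V) φ)).map (Ideal.Quotient.mk Q) := by
      rw [Finset.prod_congr rfl (g := fun _ => X), Finset.prod_const, Nat.card_eq_fintype_card,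
        Fintype.card_subtype]
      intro φ hφ
      have h2 : Ideal.Quotient.mk Q (SymmetricAlgebra.ι F (Module.Dual F V) φ) = 0 :=
        Ideal.Quotient.eq_zero_iff_mem.2 (Finset.mem_filter.1 hφ).2
      rw [Polynomial.map_add, map_X, map_C, h2, C_0, add_zero]
    rw [h1]
    exact Finset.prod_dvd_prod_of_subset _ _ _ (Finset.filter_subset _ _)
  exact X_pow_dvd_iff.1 hdvd _ (Nat.pow_lt_pow_right Finite.one_lt_card hj)

/-- Every linear form is a root of the Dickson product, which is monic with invariant coefficients.
-/
instance isIntegral_invariantRing : Algebra.IsIntegral (invariantRing G) (PolyFun F V) := by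
  constructor
  intro r
  induction r using SymmetricAlgebra.induction with
  | algebraMap a => exact isIntegral_algebraMap (x := algebraMap F (invariantRing G) a)
  | ι φ =>
    have hl : dicksonProduct F V ∈ lifts (algebraMap (invariantRing G) (PolyFun F V)) := by
      rw [lifts_iff_coeff_lifts]
      intro n
      refine ⟨⟨(dicksonProduct F V).coeff n, fun g _ => ?_⟩, rfl⟩
      have h := congrArg (fun f => coeff f n) (map_act_dicksonProduct (F := F) (V := V) g)
      simpa only [coeff_map] using! h
    obtain ⟨p, hp, -, hm⟩ := lifts_and_degree_eq_and_monic hl dicksonProduct_monic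
    refine ⟨p, hm, ?_⟩
    rw [← eval_map, hp, eval_dicksonProduct]
  | mul x z hx hz => exact hx.mul hz
  | add x z hx hz => exact hx.add hz

instance finiteType_polyFun : Algebra.FiniteType F (PolyFun F V) :=
  Algebra.FiniteType.equiv inferInstance
    (SymmetricAlgebra.equivMvPolynomial (Module.finBasis F (Module.Dual F V))).symm

/-- The Artin–Tate lemma for `F ⊆ S ⊆ R`, with `R` finite over `S`. -/
instance isNoetherianRing_invariantRing : IsNoetherianRing (invariantRing G) := by
  have : Algebra.FiniteType (invariantRing G) (PolyFun F V) :=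
    Algebra.FiniteType.of_restrictScalars_finiteType F _ _
  have hfin : Module.Finite (invariantRing G) (PolyFun F V) := Algebra.IsIntegral.finite
  have : Algebra.FiniteType F (invariantRing G) :=
    ⟨fg_of_fg_of_fg F (invariantRing G) (PolyFun F V) Algebra.FiniteType.out hfin.1
      Subtype.val_injective⟩
  exact Algebra.FiniteType.isNoetherianRing F _

/-- A prime of the ring of invariants which is stable under Steenrod operations contains the
Dickson invariants of index smaller than its codimension. -/
theorem dickson_mem_of_steenrod_stable (p : Ideal (invariantRing G)) [p.IsPrime]
    (hp : ∀ k, ∀ s ∈ p, ∀ j, (invariantSteenrod G k s).coeff j ∈ p) {g : ℕ}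
    (hg : ringKrullDim (invariantRing G ⧸ p) + (g : ℕ) ≤ (Module.finrank F V : ℕ)) {j : ℕ}
    (hj : j < g) : dickson G j ∈ p := by
  let a := algebraMap (invariantRing G) (PolyFun F V)
  obtain ⟨Q₀, -, hQ₀, hQ₀p⟩ := Ideal.exists_ideal_over_prime_of_isIntegral p
    (⊥ : Ideal (PolyFun F V)) (by
      intro x hx
      rw [show x = 0 from Subtype.ext hx]
      exact p.zero_mem)
  have hle : p.map a ≤ Q₀ := Ideal.map_le_iff_le_comap.2 hQ₀p.ge
  -- Lying over alone gives no stability. A minimal prime of the stable ideal `pR` is stable, and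
  -- inside `Q₀` it still contracts to `p`.
  obtain ⟨Q, hQ, hQQ₀⟩ := Ideal.exists_minimalPrimes_le hle
  have : Q.IsPrime := hQ.1.1
  have hQp : Q.comap a = p :=
    le_antisymm ((Ideal.comap_mono hQQ₀).trans hQ₀p.le) (Ideal.map_le_iff_le_comap.1 hQ.1.2)
  have hmap : ∀ k, ∀ r ∈ p.map a, ∀ i, (steenrod F (Module.Dual F V) k r).coeff i ∈ p.map a := by
    intro k
    have h1 : p.map a ≤ ((p.map a).map C).comap (steenrod F (Module.Dual F V) k).toRingHom := by
      rw [Ideal.map_le_iff_le_comap]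
      intro s hs
      refine Ideal.mem_comap.2 (Ideal.mem_comap.2 (Ideal.mem_map_C_iff.2 fun i => ?_))
      have h2 := Ideal.mem_map_of_mem a (hp k s hs i)
      rwa [show a _ = _ from coe_coeff_invariantSteenrod G k s i] at h2
    exact fun r hr => Ideal.mem_map_C_iff.1 (h1 hr)
  have hdim := ringKrullDim_quotient_of_steenrod_stable Q fun k r hr =>
    coeff_mem_of_mem_minimalPrimes (P := (steenrod F (Module.Dual F V) k).toRingHom)
      (steenrod_coeff_zero k) (hmap k) hQ r hr 1
  have hle2 := ringKrullDim_quotient_le_of_isIntegral (A := invariantRing G) Q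
  rw [show Q.comap (algebraMap (invariantRing G) (PolyFun F V)) = p from hQp, hdim] at hle2
  have h3 : ((Module.finrank F (Module.Dual F V ⧸ linearForms Q) : ℕ) : WithBot ℕ∞) + (g : ℕ) ≤
      (Module.finrank F V : ℕ) := (by gcongr : _ ≤ _).trans hg
  have h4 : Module.finrank F (Module.Dual F V ⧸ linearForms Q) + g ≤ Module.finrank F V := by
    exact_mod_cast h3
  have h5 := Submodule.finrank_quotient_add_finrank (linearForms Q)
  rw [Subspace.dual_finrank_eq] at h5
  have h6 : dicksonPoly F V j ∈ Q := dicksonPoly_mem Q (by omega)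
  rw [← hQp]
  exact h6

end Invariants

end ModularInvariants

end

theorem theorem1p1 {F : Type*} [Field F] [Finite F] {V : Type*} [AddCommGroup V] [Module F V]
    [FiniteDimensional F V] (G : Subgroup (LinearMap.GeneralLinearGroup F V))
    (I : Ideal (ModularInvariants.invariantRing G)) (hI : ModularInvariants.IsHomogeneousIdeal I)
    (i g : ℕ) (hJ : ModularInvariants.cohomologicalRadical I i ≠ ⊥)
    (hdim : ringKrullDim
        (ModularInvariants.invariantRing G ⧸ ModularInvariants.cohomologicalRadical I i) + (g : ℕ) =
      (Module.finrank F V : ℕ)) :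
    ∀ j < g, ModularInvariants.dickson G j ∈ ModularInvariants.cohomologicalRadical I i := by
  intro j hj
  rw [ModularInvariants.cohomologicalRadical, ← Ideal.sInf_minimalPrimes, Ideal.mem_sInf]
  intro p hp
  have : p.IsPrime := hp.1.1
  have hle : ModularInvariants.cohomologicalRadical I i ≤ p := this.radical_le_iff.2 hp.1.2
  have hcoeff : ∀ k s, ((ModularInvariants.invariantSteenrod G k) s).coeff 0 = s := fun k s =>
    Subtype.ext ((ModularInvariants.coe_coeff_invariantSteenrod G k s 0).trans
      (ModularInvariants.steenrod_coeff_zero k _))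
  refine ModularInvariants.dickson_mem_of_steenrod_stable G p (fun k =>
    ModularInvariants.coeff_mem_of_mem_minimalPrimes (hcoeff k)
      (fun a ha j => ModularInvariants.coeff_mem_lcAnnihilator (hcoeff k) ha j) hp) ?_ hj
  rw [← hdim]
  gcongr
  -- Since `p` contains `J_i`, the dimension of `S/p` is at most that of `S/J_i`.
  exact ringKrullDim_le_of_surjective (Ideal.Quotient.factor hle)
    (Ideal.Quotient.factor_surjective hle)
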